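/- Let $n\in\mathbb N$. A (not necessarily symmetric) semi-norm on $\mathbb R^n$ is a function $\|\cdot\|_K:\mathbb R^n\to[0,\infty)$ with $\|x+y\|_K\le\|x\|_K+\|y\|_K$ and $\|\lambda x\|_K=\lambda\|x\|_K$ for all $\lambda\ge0$; let $K=\{x:\|x\|_K<1\}$ be its open unit ball. For a Borel measure $\mu$ on $\mathbb R^n$ and a Borel set $C$, define the inner Minkowski boundary measure $$\mu^-_{K}(C)=\liminf_{\varepsilon\to0^+}\frac{\mu\big(((\mathbb R^n\setminus C)+\varepsilon K)\setminus(\mathbb R^n\setminus C)\big)}{\varepsilon}.$$ Powers are taken in $[0,\infty]$, with $0^r=\infty$ and $\infty^r=0$ for $r<0$, and $0\cdot\infty=0$. For $q<0$, the measure $\mu$ is called $q$-homogeneous if $\mu(\lambda A)^q=\lambda\,\mu(A)^q$ for all Borel $A\subset\mathbb R^n$ and all $\lambda>0$; for $p<0$, a Borel function $w:\mathbb R^n\setminus\{0\}\to[0,\infty)$ is called $p$-homogeneous if $w(\lambda x)^p=\lambda\,w(x)^p$ for all $x\ne0$ and all $\lambda>0$. Assume that either (a) $q<0$ and $\mu$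 is a $\sigma$-finite $q$-homogeneous Borel measure on $\mathbb R^n$, or (b) $n\ge1$ and $\mu=w(x)\,dx$, where $w:\mathbb R^n\setminus\{0\}\to[0,\infty)$ is a $p$-homogeneous Borel density with $p\in(-1/n,0)$, and $\frac1q=\frac1p+n$. Assume further that $\mu(\mathbb R^n\setminus K)<\infty$. Then for every Borel set $C\subset\mathbb R^n$ with $\mu(C)<\infty$, $$\mu^-_{K}(C)\ \ge\ -\frac1q\,\mu(\mathbb R^n\setminus K)^q\,\mu(C)^{1-q},$$ and equality holds for $C=\mathbb R^n\setminus tK$, for every $t>0$. In other words, complements of homothetic copies of $K$ are isoperimetric minimizers: for every $t>0$ and every Borel set $D$ with $\mu(D)=\mu(\mathbb R^n\setminus tK)$, one has $\mu^-_{K}(\mathbb R^n\setminus tK)\le\mu^-_{K}(D)$. -/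

import Mathlib

open MeasureTheory Filter Topology
open scoped ENNReal NNReal Pointwise

/-- A semi-norm that is not required to be symmetric: non-negative, positively homogeneous
and subadditive. -/
structure IsPosSeminorm {n : ℕ} (N : EuclideanSpace ℝ (Fin n) → ℝ) : Prop where
  nonneg : ∀ x, 0 ≤ N x
  smul_eq : ∀ (r : ℝ) (x : EuclideanSpace ℝ (Fin n)), 0 ≤ r → N (r • x) = r * N x
  add_le : ∀ x y, N (x + y) ≤ N x + N y

/-- The open unit ball `{x | N x < 1}`. -/
def openUnitBall {n : ℕ} (N : EuclideanSpace ℝ (Fin n) → ℝ) : Set (EuclideanSpace ℝ (Fin n)) :=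
  {x | N x < 1}

/-- The outer Minkowski boundary measure of `A` relative to `B`:
the lower limit of `μ ((A + ε B) \ A) / ε` as `ε → 0+`. -/
noncomputable def outerBoundaryMeasure {n : ℕ} (μ : Measure (EuclideanSpace ℝ (Fin n)))
    (B A : Set (EuclideanSpace ℝ (Fin n))) : ℝ≥0∞ :=
  liminf (fun ε : ℝ => μ ((A + ε • B) \ A) / ENNReal.ofReal ε) (𝓝[>] (0 : ℝ))

/-- The inner Minkowski boundary measure of `C` relative to `B`: the outer boundary measure
of the complement of `C`. -/
noncomputable def innerBoundaryMeasure {n : ℕ} (μ : Measure (EuclideanSpace ℝ (Fin n)))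
    (B C : Set (EuclideanSpace ℝ (Fin n))) : ℝ≥0∞ :=
  outerBoundaryMeasure μ B Cᶜ

/-- `μ (t A) ^ q = t * μ (A) ^ q` for all Borel `A` and `t > 0`. Powers are taken in `[0, ∞]`,
so that `0 ^ q = ∞` and `∞ ^ q = 0` for negative `q`. -/
def IsHomogeneousMeasure {n : ℕ} (q : ℝ) (μ : Measure (EuclideanSpace ℝ (Fin n))) : Prop :=
  ∀ A : Set (EuclideanSpace ℝ (Fin n)), MeasurableSet A → ∀ t : ℝ, 0 < t →
    μ (t • A) ^ q = ENNReal.ofReal t * μ A ^ q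

/-- `w (t x) ^ p = t * w (x) ^ p` for all `x ≠ 0` and `t > 0`, with powers taken in `[0, ∞]`.
The value of `w` at the origin plays no role. -/
def IsHomogeneousDensity {n : ℕ} (p : ℝ) (w : EuclideanSpace ℝ (Fin n) → ℝ≥0) : Prop :=
  ∀ x : EuclideanSpace ℝ (Fin n), x ≠ 0 → ∀ t : ℝ, 0 < t →
    (w (t • x) : ℝ≥0∞) ^ p = ENNReal.ofReal t * (w x : ℝ≥0∞) ^ p

/-- `C` is a Borel set of least inner boundary measure among all Borel sets of the same
measure. -/
def IsInnerIsoperimetricMinimizer {n : ℕ} (μ : Measure (EuclideanSpace ℝ (Fin n)))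
    (B C : Set (EuclideanSpace ℝ (Fin n))) : Prop :=
  MeasurableSet C ∧ ∀ D : Set (EuclideanSpace ℝ (Fin n)), MeasurableSet D → μ D = μ C →
    innerBoundaryMeasure μ B C ≤ innerBoundaryMeasure μ B D

/-! Put `a = -1/q > 0`. Homogeneity says `μ (t A) = t ^ (-a) μ A`. On `{N > 0}` this splits `μ` as a
product of the density `a r ^ (-a-1)` in `r = N x` and a finite angular measure (`map_polarMap`).
Radial motion by `N`-distance `s` towards the origin, `x ↦ (1 - s / N x) x`, then has Jacobian `J =
(1 - s / N x) ^ (-a-1)` with respect to `μ` (`setLIntegral_radial_shift`). For `s < ε` this motion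
sends the points of `E = (A + ε K)ᶜ` with `N > s` into `Aᶜ`, so `∫ J` over them is at most `μ Aᶜ`.
If `μ Aᶜ = μ {N ≥ c}`, the right side equals `∫ J` over `{N ≥ c + s}`. Since `J` decreases in `N`,
superlevel sets of `N` have the least `∫ J` for their measure, which forces `μ E ≤ μ {N ≥ c + s}`;
the points of `E` with `N < ε` form a null set. Letting `s → ε` gives `measure_compl_add_le`. With
`A = Cᶜ`, difference quotients for `C` dominate those for `{N ≥ c}`, whose limit is the derivative
of a power. For `C = (t K)ᶜ` there is equality at every `ε`, because `t K + ε K = (t + ε) K`. A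
homogeneous density reduces to a homogeneous measure by scaling Lebesgue measure. -/

/-! ### Radial measures on the half-line -/

/-- The measure on `ℝ` with density `a * r ^ (-a - 1)` on the positive half-line. -/
noncomputable def radialMeasure (a : ℝ) : Measure ℝ :=
  (volume.restrict (Set.Ioi 0)).withDensity fun r => ENNReal.ofReal (a * r ^ (-a - 1))

theorem measurable_ofReal_mul_rpow (a : ℝ) :
    Measurable fun r : ℝ => ENNReal.ofReal (a * r ^ (-a - 1)) := by
  fun_prop

theorem radialMeasure_Iic_zero (a : ℝ) : radialMeasure a (Set.Iic 0) = 0 := by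
  refine withDensity_absolutelyContinuous _ _ ?_
  rw [Measure.restrict_apply measurableSet_Iic]
  convert measure_empty (μ := (volume : Measure ℝ))
  ext x
  simp

theorem radialMeasure_Ici {a : ℝ} (ha : 0 < a) {r : ℝ} (hr : 0 < r) :
    radialMeasure a (Set.Ici r) = ENNReal.ofReal (r ^ (-a)) := by
  have hint : IntegrableOn (fun x : ℝ => a * x ^ (-a - 1)) (Set.Ioi r) :=
    (integrableOn_Ioi_rpow_of_lt (by linarith) hr).const_mul a
  have hsub : Set.Ici r ∩ Set.Ioi 0 = Set.Ici r := by
    ext x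
    simp only [Set.mem_inter_iff, Set.mem_Ici, Set.mem_Ioi, and_iff_left_iff_imp]
    exact fun h => hr.trans_le h
  rw [radialMeasure, withDensity_apply _ measurableSet_Ici,
    Measure.restrict_restrict measurableSet_Ici, hsub, setLIntegral_congr Ioi_ae_eq_Ici.symm,
    ← ofReal_integral_eq_lintegral_ofReal hint, integral_const_mul,
    integral_Ioi_rpow_of_lt (by linarith) hr]
  · congr 1
    have : -a - 1 + 1 = -a := by ring
    rw [this]
    field_simp
  · filter_upwards [ae_restrict_mem measurableSet_Ioi] with x hx
    have : 0 < x := hr.trans hx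
    positivity

theorem iUnion_Ici_one_div : ⋃ k : ℕ, Set.Ici (1 / ((k : ℝ) + 1)) = Set.Ioi 0 := by
  ext x
  simp only [Set.mem_iUnion, Set.mem_Ici, Set.mem_Ioi]
  constructor
  · rintro ⟨k, hk⟩
    exact lt_of_lt_of_le (by positivity) hk
  · intro hx
    obtain ⟨k, hk⟩ := exists_nat_one_div_lt hx
    exact ⟨k, hk.le⟩

/-- The total mass may be infinite near `0`, so uniqueness is checked on each ray `[1/(k+1), ∞)`,
where the mass is finite, and these rays exhaust the positive half-line. -/
theorem eq_of_Ici_of_Iic_zero {ρ ρ' : Measure ℝ} (h0 : ρ (Set.Iic 0) = 0)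
    (h0' : ρ' (Set.Iic 0) = 0) (hfin : ∀ r, 0 < r → ρ (Set.Ici r) ≠ ∞)
    (h : ∀ r, 0 < r → ρ (Set.Ici r) = ρ' (Set.Ici r)) : ρ = ρ' := by
  have key (τ : Measure ℝ) (hτ : τ (Set.Iic 0) = 0) : τ.restrict (Set.Ioi 0) = τ := by
    refine Measure.restrict_eq_self_of_ae_mem ?_
    rw [ae_iff]
    simpa [Set.Iic_def] using hτ
  rw [← key ρ h0, ← key ρ' h0', ← iUnion_Ici_one_div, Measure.restrict_iUnion_congr]
  intro k
  have hk : (0 : ℝ) < 1 / ((k : ℝ) + 1) := by positivity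
  have : IsFiniteMeasure (ρ.restrict (Set.Ici (1 / ((k : ℝ) + 1)))) :=
    ⟨by simpa using (hfin _ hk).lt_top⟩
  refine Measure.ext_of_Ici _ _ fun x => ?_
  rw [Measure.restrict_apply measurableSet_Ici, Measure.restrict_apply measurableSet_Ici,
    Set.Ici_inter_Ici]
  exact h _ (lt_sup_of_lt_right hk)

instance sigmaFinite_radialMeasure (a : ℝ) : SigmaFinite (radialMeasure a) := by
  unfold radialMeasure
  infer_instance

/-! ### Non-symmetric semi-norms and their balls -/

namespace IsPosSeminorm

variable {n : ℕ} {N : EuclideanSpace ℝ (Fin n) → ℝ}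

theorem map_zero (hN : IsPosSeminorm N) : N 0 = 0 := by
  simpa using hN.smul_eq 0 0 le_rfl

theorem continuous (hN : IsPosSeminorm N) : Continuous N := by
  -- A finite convex function on a finite-dimensional space is continuous.
  have hc : ConvexOn ℝ Set.univ N := by
    refine ⟨convex_univ, fun x _ y _ s t hs ht _ => ?_⟩
    simpa [hN.smul_eq s x hs, hN.smul_eq t y ht] using hN.add_le (s • x) (t • y)
  exact continuousOn_univ.1 (hc.continuousOn isOpen_univ)

theorem smul_openUnitBall (hN : IsPosSeminorm N) {t : ℝ} (ht : 0 < t) :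
    t • openUnitBall N = {x | N x < t} := by
  ext x
  rw [Set.mem_smul_set_iff_inv_smul_mem₀ ht.ne']
  simp only [openUnitBall, Set.mem_ofPred_eq]
  rw [hN.smul_eq _ _ (inv_nonneg.2 ht.le), inv_mul_lt_iff₀ ht, mul_one]

theorem compl_openUnitBall (N : EuclideanSpace ℝ (Fin n) → ℝ) :
    (openUnitBall N)ᶜ = {x | 1 ≤ N x} := by
  ext x
  simp [openUnitBall]

theorem smul_setOf_le (hN : IsPosSeminorm N) {t : ℝ} (ht : 0 < t)
    (Θ : Set (EuclideanSpace ℝ (Fin n))) :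
    t • {x | 1 ≤ N x ∧ (N x)⁻¹ • x ∈ Θ} = {x | t ≤ N x ∧ (N x)⁻¹ • x ∈ Θ} := by
  ext x
  rw [Set.mem_smul_set_iff_inv_smul_mem₀ ht.ne']
  simp only [Set.mem_ofPred_eq]
  rw [hN.smul_eq _ _ (inv_nonneg.2 ht.le), le_inv_mul_iff₀ ht, mul_one, smul_smul,
    mul_inv, inv_inv, mul_right_comm, mul_inv_cancel₀ ht.ne', one_mul]

theorem smul_setOf_one_le (hN : IsPosSeminorm N) {t : ℝ} (ht : 0 < t) :
    t • {x | 1 ≤ N x} = {x | t ≤ N x} := by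
  simpa using hN.smul_setOf_le ht Set.univ

end IsPosSeminorm

/-! ### Polar decomposition and the radial shift -/

section Polar

variable {n : ℕ} {N : EuclideanSpace ℝ (Fin n) → ℝ} {μ : Measure (EuclideanSpace ℝ (Fin n))}
  {a : ℝ}

/-- The map sending `x` to its radial part `N x` and its angular part `x / N x`. -/
noncomputable def polarMap (N : EuclideanSpace ℝ (Fin n) → ℝ) (x : EuclideanSpace ℝ (Fin n)) :
    ℝ × EuclideanSpace ℝ (Fin n) :=
  (N x, (N x)⁻¹ • x)

theorem measurable_polarMap (hN : IsPosSeminorm N) : Measurable (polarMap N) := by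
  have := hN.continuous.measurable
  unfold polarMap
  fun_prop

/-- The angular part of a measure outside the open unit ball. -/
noncomputable def angularMeasure (N : EuclideanSpace ℝ (Fin n) → ℝ)
    (μ : Measure (EuclideanSpace ℝ (Fin n))) : Measure (EuclideanSpace ℝ (Fin n)) :=
  (μ.restrict {x | 1 ≤ N x}).map fun x => (N x)⁻¹ • x

/-- Dilations fix the angular part, so the truncated cones over a fixed `Θ` have measure `r ^ (-a)`
times that of the cone from level `1`. These tails determine the radial law over each `Θ`, hence the
measure of every rectangle. -/
theorem map_polarMap (hN : IsPosSeminorm N) (ha : 0 < a)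
    (hμ : ∀ A, MeasurableSet A → ∀ t : ℝ, 0 < t → μ (t • A) = ENNReal.ofReal (t ^ (-a)) * μ A)
    (hfin : μ {x | 1 ≤ N x} ≠ ∞) :
    (μ.restrict {x | 0 < N x}).map (polarMap N) = (radialMeasure a).prod (angularMeasure N μ) := by
  have hNm := hN.continuous.measurable
  have hθ : Measurable fun x : EuclideanSpace ℝ (Fin n) => (N x)⁻¹ • x := by fun_prop
  have hpos : MeasurableSet {x | 0 < N x} := measurableSet_lt measurable_const hNm
  have hone : MeasurableSet {x | 1 ≤ N x} := measurableSet_le measurable_const hNm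
  have : IsFiniteMeasure (angularMeasure N μ) := by
    have : IsFiniteMeasure (μ.restrict {x | 1 ≤ N x}) := ⟨by simpa using hfin.lt_top⟩
    unfold angularMeasure
    infer_instance
  symm
  refine Measure.prod_eq fun R Θ hR hΘ => ?_
  have hang : angularMeasure N μ Θ = μ {x | 1 ≤ N x ∧ (N x)⁻¹ • x ∈ Θ} := by
    rw [angularMeasure, Measure.map_apply hθ hΘ, Measure.restrict_apply (hθ hΘ), Set.inter_comm]
    rfl
  have hangm : MeasurableSet {x | 1 ≤ N x ∧ (N x)⁻¹ • x ∈ Θ} := hone.inter (hθ hΘ)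
  have hangfin : angularMeasure N μ Θ ≠ ∞ := measure_ne_top _ _
  have key : (μ.restrict {x | 0 < N x ∧ (N x)⁻¹ • x ∈ Θ}).map N =
      angularMeasure N μ Θ • radialMeasure a := by
    have hval (r : ℝ) (hr : 0 < r) : (μ.restrict {x | 0 < N x ∧ (N x)⁻¹ • x ∈ Θ}).map N
        (Set.Ici r) = ENNReal.ofReal (r ^ (-a)) * angularMeasure N μ Θ := by
      rw [Measure.map_apply hNm measurableSet_Ici, Measure.restrict_apply (hNm measurableSet_Ici),
        hang, ← hμ _ hangm r hr, hN.smul_setOf_le hr]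
      congr 1
      ext x
      simp only [Set.mem_inter_iff, Set.mem_preimage, Set.mem_Ici, Set.mem_ofPred_eq]
      exact ⟨fun h => ⟨h.1, h.2.2⟩, fun h => ⟨h.1, hr.trans_le h.1, h.2⟩⟩
    refine eq_of_Ici_of_Iic_zero ?_ ?_ (fun r hr => ?_) (fun r hr => ?_)
    · rw [Measure.map_apply hNm measurableSet_Iic, Measure.restrict_apply (hNm measurableSet_Iic)]
      convert measure_empty (μ := μ)
      ext x
      simp only [Set.mem_inter_iff, Set.mem_preimage, Set.mem_Iic, Set.mem_ofPred_eq,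
        Set.mem_empty_iff_false, iff_false]
      exact fun h => absurd h.2.1 (not_lt.2 h.1)
    · simp [radialMeasure_Iic_zero]
    · rw [hval r hr]
      exact ENNReal.mul_ne_top ENNReal.ofReal_ne_top hangfin
    · rw [hval r hr, Measure.smul_apply, radialMeasure_Ici ha hr, smul_eq_mul, mul_comm]
  have h := congrArg (fun τ => τ R) key
  simp only [Measure.smul_apply, smul_eq_mul] at h
  rw [mul_comm, ← h, Measure.map_apply hNm hR, Measure.restrict_apply (hNm hR),
    Measure.map_apply (measurable_polarMap hN) (hR.prod hΘ),
    Measure.restrict_apply (measurable_polarMap hN (hR.prod hΘ))]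
  congr 1
  ext x
  simp only [polarMap, Set.mem_inter_iff, Set.mem_preimage, Set.mem_prod, Set.mem_ofPred_eq]
  tauto

theorem setLIntegral_eq_polar (hN : IsPosSeminorm N) (ha : 0 < a)
    (hμ : ∀ A, MeasurableSet A → ∀ t : ℝ, 0 < t → μ (t • A) = ENNReal.ofReal (t ^ (-a)) * μ A)
    (hfin : μ {x | 1 ≤ N x} ≠ ∞) {f : EuclideanSpace ℝ (Fin n) → ℝ → ℝ≥0∞}
    (hf : Measurable (Function.uncurry f)) :
    ∫⁻ x in {x | 0 < N x}, f ((N x)⁻¹ • x) (N x) ∂μ =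
      ∫⁻ θ, (∫⁻ r in Set.Ioi (0 : ℝ), ENNReal.ofReal (a * r ^ (-a - 1)) * f θ r)
        ∂(angularMeasure N μ) := by
  have : IsFiniteMeasure (angularMeasure N μ) := by
    have : IsFiniteMeasure (μ.restrict {x | 1 ≤ N x}) := ⟨by simpa using hfin.lt_top⟩
    unfold angularMeasure
    infer_instance
  have hg : Measurable fun p : ℝ × EuclideanSpace ℝ (Fin n) => f p.2 p.1 :=
    hf.comp measurable_swap
  have h1 : ∫⁻ x in {x | 0 < N x}, f ((N x)⁻¹ • x) (N x) ∂μ =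
      ∫⁻ p, f p.2 p.1 ∂((μ.restrict {x | 0 < N x}).map (polarMap N)) := by
    rw [lintegral_map hg (measurable_polarMap hN)]
    rfl
  rw [h1, map_polarMap hN ha hμ hfin, lintegral_prod_symm _ hg.aemeasurable]
  refine lintegral_congr fun θ => ?_
  rw [radialMeasure, lintegral_withDensity_eq_lintegral_mul _ (measurable_ofReal_mul_rpow a)]
  · rfl
  · exact hf.comp (measurable_const.prodMk measurable_id)

/-- Change of variables for the map `x ↦ (1 - s / N x) • x`, which moves `x` towards the origin
by the `N`-distance `s`. -/
theorem setLIntegral_radial_shift (hN : IsPosSeminorm N) (ha : 0 < a)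
    (hμ : ∀ A, MeasurableSet A → ∀ t : ℝ, 0 < t → μ (t • A) = ENNReal.ofReal (t ^ (-a)) * μ A)
    (hfin : μ {x | 1 ≤ N x} ≠ ∞) {s : ℝ} (hs : 0 < s) {C : Set (EuclideanSpace ℝ (Fin n))}
    (hC : MeasurableSet C) :
    ∫⁻ x in {x | s < N x ∧ (1 - s / N x) • x ∈ C},
      ENNReal.ofReal ((1 - s / N x) ^ (-a - 1)) ∂μ = μ (C ∩ {x | 0 < N x}) := by
  have hNm := hN.continuous.measurable
  have hpos : MeasurableSet {x | 0 < N x} := measurableSet_lt measurable_const hNm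
  have hcone {x : EuclideanSpace ℝ (Fin n)} (hx : 0 < N x) (r : ℝ) :
      (N x * r) • (N x)⁻¹ • x = r • x := by
    rw [smul_smul, mul_right_comm, mul_inv_cancel₀ hx.ne', one_mul]
  have hR : μ (C ∩ {x | 0 < N x}) =
      ∫⁻ θ, (∫⁻ r in Set.Ioi (0 : ℝ), ENNReal.ofReal (a * r ^ (-a - 1)) * C.indicator 1 (r • θ))
        ∂(angularMeasure N μ) := by
    rw [← setLIntegral_eq_polar (f := fun θ r => C.indicator 1 (r • θ)) hN ha hμ hfin
      ((measurable_one.indicator hC).comp (measurable_snd.smul measurable_fst)),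
      ← Measure.restrict_apply hC, ← lintegral_indicator_one hC]
    refine setLIntegral_congr_fun hpos fun x hx => ?_
    have := hcone hx 1
    rw [mul_one, one_smul] at this
    simp only [this]
  have hfm : Measurable (Function.uncurry fun (θ : EuclideanSpace ℝ (Fin n)) (r : ℝ) =>
      (Set.Ioi s).indicator (fun _ => (1 : ℝ≥0∞)) r *
        (ENNReal.ofReal ((1 - s / r) ^ (-a - 1)) * C.indicator 1 ((r - s) • θ))) := by
    refine Measurable.mul ?_ (Measurable.mul ?_ ?_)
    · exact (measurable_const.indicator measurableSet_Ioi).comp measurable_snd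
    · fun_prop
    · exact (measurable_one.indicator hC).comp
        ((measurable_snd.sub measurable_const).smul measurable_fst)
  have hDm : MeasurableSet {x | s < N x ∧ (1 - s / N x) • x ∈ C} :=
    (measurableSet_lt measurable_const hNm).inter
      ((show Measurable fun x => (1 - s / N x) • x by fun_prop) hC)
  rw [hR]
  trans ∫⁻ θ, (∫⁻ r in Set.Ioi (0 : ℝ), ENNReal.ofReal (a * r ^ (-a - 1)) *
      ((Set.Ioi s).indicator (fun _ => (1 : ℝ≥0∞)) r *
        (ENNReal.ofReal ((1 - s / r) ^ (-a - 1)) * C.indicator 1 ((r - s) • θ))))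
          ∂(angularMeasure N μ)
  · rw [← setLIntegral_eq_polar hN ha hμ hfin hfm, ← lintegral_indicator hDm,
      ← lintegral_indicator hpos]
    refine lintegral_congr fun x => ?_
    by_cases hx : s < N x
    · have hx0 : 0 < N x := hs.trans hx
      have hsc : (N x - s) • (N x)⁻¹ • x = (1 - s / N x) • x := by
        rw [← hcone hx0 (1 - s / N x), mul_sub, mul_one, mul_div_cancel₀ _ hx0.ne']
      by_cases hxC : (1 - s / N x) • x ∈ C
      · simp [Set.indicator, hx, hx0, hxC, hsc]
      · simp [Set.indicator, hx, hxC, hsc]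
    · simp [Set.indicator, hx]
  · refine lintegral_congr fun θ => ?_
    -- After the substitution `r ↦ r + s`, the Jacobian weight turns the radial density at `r + s`
    -- into the one at `r`.
    rw [← lintegral_indicator measurableSet_Ioi, ← lintegral_indicator measurableSet_Ioi,
      ← lintegral_add_right_eq_self _ s]
    refine lintegral_congr fun r => ?_
    by_cases hr : 0 < r
    · have hrs : 0 < r + s := by positivity
      have h1 : 1 - s / (r + s) = r / (r + s) := by
        field_simp
        ring
      have h2 : (a * (r + s) ^ (-a - 1)) * (r / (r + s)) ^ (-a - 1) = a * r ^ (-a - 1) := by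
        rw [mul_assoc, ← Real.mul_rpow hrs.le (by positivity), mul_div_cancel₀ _ hrs.ne']
      simp only [Set.indicator, Set.mem_Ioi, hr, hrs, if_true, lt_add_iff_pos_left, one_mul, h1]
      rw [add_sub_cancel_right, ← mul_assoc, ← ENNReal.ofReal_mul (by positivity), h2]
    · simp [Set.indicator, hr]

end Polar


/-! ### Bathtub principle -/

/-- The common part `F ∩ E` cancels, having finite integral; on the two differences `H` separates
the values of `h`, and `E \ F` has the larger measure. -/
theorem setLIntegral_lt_of_measure_lt {α : Type*} [MeasurableSpace α] {μ : Measure α}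
    {E F : Set α} (hE : MeasurableSet E) (hF : MeasurableSet F) {h : α → ℝ≥0∞} {H : ℝ≥0∞}
    (hH0 : H ≠ 0) (hH : H ≠ ∞) (hhF : ∀ x ∈ F, h x ≤ H) (hhE : ∀ x ∈ E \ F, H ≤ h x)
    (hlt : μ F < μ E) : ∫⁻ x in F, h x ∂μ < ∫⁻ x in E, h x ∂μ := by
  have hFfin : μ F ≠ ∞ := hlt.ne_top
  have hdiff : μ (F \ E) < μ (E \ F) := by
    rw [← measure_inter_add_sdiff F hE, ← measure_inter_add_sdiff E hF, Set.inter_comm F E] at hlt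
    exact lt_of_add_lt_add_left hlt
  have hle (G : Set α) (hG : G ⊆ F) (hGm : MeasurableSet G) : ∫⁻ x in G, h x ∂μ ≤ H * μ G := by
    rw [← setLIntegral_const]
    exact setLIntegral_mono_ae aemeasurable_const (ae_of_all _ fun x hx => hhF x (hG hx))
  have hge : H * μ (E \ F) ≤ ∫⁻ x in E \ F, h x ∂μ := by
    rw [← setLIntegral_const]
    exact setLIntegral_mono' (hE.diff hF) hhE
  have hint : ∫⁻ x in F ∩ E, h x ∂μ ≠ ∞ :=
    ne_top_of_le_ne_top (ENNReal.mul_ne_top hH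
      (ne_top_of_le_ne_top hFfin (measure_mono Set.inter_subset_left)))
      (hle _ Set.inter_subset_left (hF.inter hE))
  rw [← lintegral_inter_add_sdiff h F hE, ← lintegral_inter_add_sdiff h E hF, Set.inter_comm E F]
  refine ENNReal.add_lt_add_left hint ?_
  calc ∫⁻ x in F \ E, h x ∂μ ≤ H * μ (F \ E) := hle _ Set.sdiff_subset (hF.diff hE)
    _ < H * μ (E \ F) := ENNReal.mul_lt_mul_right hH0 hH hdiff
    _ ≤ _ := hge

/-! ### Measure of the complement of an enlargement -/

section Enlargement

variable {n : ℕ} {N : EuclideanSpace ℝ (Fin n) → ℝ} {μ : Measure (EuclideanSpace ℝ (Fin n))}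
  {a : ℝ} {A : Set (EuclideanSpace ℝ (Fin n))} {ε : ℝ}

theorem measurableSet_add_smul_openUnitBall (hN : IsPosSeminorm N) (hε : 0 < ε) :
    MeasurableSet (A + ε • openUnitBall N) := by
  rw [hN.smul_openUnitBall hε]
  exact (isOpen_lt hN.continuous continuous_const).add_left.measurableSet

theorem subset_add_smul_openUnitBall (hN : IsPosSeminorm N) (hε : 0 < ε) :
    A ⊆ A + ε • openUnitBall N := by
  rw [hN.smul_openUnitBall hε]
  intro x hx
  exact ⟨x, hx, 0, by simpa [hN.map_zero] using hε, add_zero x⟩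

/-- Moving a point of the complement of `A + ε K` towards the origin by an `N`-distance less
than `ε` gives a point of the complement of `A`. -/
theorem smul_mem_compl_of_mem_compl_add (hN : IsPosSeminorm N) (hε : 0 < ε)
    {x : EuclideanSpace ℝ (Fin n)} (hx : x ∈ (A + ε • openUnitBall N)ᶜ) {t : ℝ} (ht : t ≤ 1)
    (hxt : (1 - t) * N x < ε) : t • x ∈ Aᶜ := by
  intro hA
  refine hx ?_
  rw [hN.smul_openUnitBall hε]
  refine ⟨t • x, hA, (1 - t) • x, ?_, ?_⟩
  · rw [Set.mem_ofPred_eq, hN.smul_eq _ _ (by linarith)]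
    exact hxt
  · simp [← add_smul]

/-- Every contraction of this set by `t ≤ 1` stays in `Aᶜ`, while its measure is multiplied by `t ^
(-a)`, which is unbounded as `t → 0`. A positive measure would thus contradict finiteness of `μ Aᶜ`.
-/
theorem measure_compl_add_inter_lt (hN : IsPosSeminorm N) (ha : 0 < a)
    (hμ : ∀ A, MeasurableSet A → ∀ t : ℝ, 0 < t → μ (t • A) = ENNReal.ofReal (t ^ (-a)) * μ A)
    (hε : 0 < ε) (hAfin : μ Aᶜ ≠ ∞) :
    μ ((A + ε • openUnitBall N)ᶜ ∩ {x | N x < ε}) = 0 := by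
  by_contra h0
  obtain ⟨k, hk⟩ := ENNReal.exists_nat_mul_gt h0 hAfin
  have hk1 : (1 : ℝ) ≤ k + 1 := by simp
  -- Chosen so that `t ^ (-a) = k + 1`; using `k + 1` instead of `k` ensures `t ≤ 1`.
  set t : ℝ := ((k : ℝ) + 1) ^ (-a⁻¹) with ht
  have ht0 : 0 < t := by positivity
  have ht1 : t ≤ 1 := Real.rpow_le_one_of_one_le_of_nonpos hk1 (by simpa using ha.le)
  have hta : t ^ (-a) = k + 1 := by
    rw [ht, ← Real.rpow_mul (by positivity), neg_mul_neg, inv_mul_cancel₀ ha.ne', Real.rpow_one]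
  have hm : MeasurableSet ((A + ε • openUnitBall N)ᶜ ∩ {x | N x < ε}) :=
    (measurableSet_add_smul_openUnitBall hN hε).compl.inter
      (measurableSet_lt hN.continuous.measurable measurable_const)
  have hsub : t • ((A + ε • openUnitBall N)ᶜ ∩ {x | N x < ε}) ⊆ Aᶜ := by
    rintro _ ⟨x, ⟨hx, hxε⟩, rfl⟩
    refine smul_mem_compl_of_mem_compl_add hN hε hx ht1 (lt_of_le_of_lt ?_ hxε)
    exact mul_le_of_le_one_left (hN.nonneg x) (by linarith)
  have hle := measure_mono (μ := μ) hsub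
  rw [hμ _ hm t ht0, hta] at hle
  refine absurd hle (not_le.2 (hk.trans_le ?_))
  gcongr
  rw [← ENNReal.ofReal_natCast]
  exact ENNReal.ofReal_le_ofReal (by linarith)

theorem measure_setOf_le (hN : IsPosSeminorm N)
    (hμ : ∀ A, MeasurableSet A → ∀ t : ℝ, 0 < t → μ (t • A) = ENNReal.ofReal (t ^ (-a)) * μ A)
    {r : ℝ} (hr : 0 < r) :
    μ {x | r ≤ N x} = ENNReal.ofReal (r ^ (-a)) * μ {x | 1 ≤ N x} := by
  rw [← hμ _ (measurableSet_le measurable_const hN.continuous.measurable) r hr,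
    hN.smul_setOf_one_le hr]

/-- The shift lowers `N` by exactly `s`, so `{N ≥ c + s}` is the preimage of `{N ≥ c}`: the extremal
case of the comparison. -/
theorem setLIntegral_radial_jacobian (hN : IsPosSeminorm N) (ha : 0 < a)
    (hμ : ∀ A, MeasurableSet A → ∀ t : ℝ, 0 < t → μ (t • A) = ENNReal.ofReal (t ^ (-a)) * μ A)
    (hfin : μ {x | 1 ≤ N x} ≠ ∞) {c s : ℝ} (hc : 0 < c) (hs : 0 < s) :
    ∫⁻ x in {x | c + s ≤ N x}, ENNReal.ofReal ((1 - s / N x) ^ (-a - 1)) ∂μ =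
      μ {x | c ≤ N x} := by
  have h := setLIntegral_radial_shift hN ha hμ hfin hs
    (measurableSet_le measurable_const hN.continuous.measurable : MeasurableSet {x | c ≤ N x})
  have h1 : {x | c ≤ N x} ∩ {x | 0 < N x} = {x | c ≤ N x} :=
    Set.inter_eq_left.2 fun x hx => hc.trans_le hx
  have h2 : {x | s < N x ∧ (1 - s / N x) • x ∈ {x | c ≤ N x}} = {x | c + s ≤ N x} := by
    ext x
    simp only [Set.mem_ofPred_eq]
    have key (hx : s < N x) : N ((1 - s / N x) • x) = N x - s := by
      have hx0 : 0 < N x := hs.trans hx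
      rw [hN.smul_eq _ _ (by rw [sub_nonneg, div_le_one hx0]; exact hx.le), sub_mul,
        div_mul_cancel₀ _ hx0.ne', one_mul]
    constructor
    · rintro ⟨hx, hcx⟩
      rw [key hx] at hcx
      linarith
    · intro hx
      have hsx : s < N x := by linarith
      rw [key hsx]
      exact ⟨hsx, by linarith⟩
  rwa [h1, h2] at h

/-- Bathtub comparison of `E` with `{N ≥ c + s}`, the threshold being the Jacobian at `N = c + s`.
The strict `s < ε` is needed because the ball is open, and it lets `{N > s}` and `{N < ε}` cover the
space. -/
theorem measure_compl_add_le_of_lt (hN : IsPosSeminorm N) (ha : 0 < a)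
    (hμ : ∀ A, MeasurableSet A → ∀ t : ℝ, 0 < t → μ (t • A) = ENNReal.ofReal (t ^ (-a)) * μ A)
    (hfin : μ {x | 1 ≤ N x} ≠ ∞) (hA : MeasurableSet A) {c s : ℝ} (hc : 0 < c) (hs : 0 < s)
    (hsε : s < ε) (hAc : μ Aᶜ = μ {x | c ≤ N x}) :
    μ (A + ε • openUnitBall N)ᶜ ≤ μ {x | c + s ≤ N x} := by
  have hε : 0 < ε := hs.trans hsε
  have hNm := hN.continuous.measurable
  have hAfin : μ Aᶜ ≠ ∞ := by
    rw [hAc, measure_setOf_le hN hμ hc]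
    exact ENNReal.mul_ne_top ENNReal.ofReal_ne_top hfin
  set E := (A + ε • openUnitBall N)ᶜ with hEdef
  have hEm : MeasurableSet E := (measurableSet_add_smul_openUnitBall hN hε).compl
  have hsm : MeasurableSet {x | s < N x} := measurableSet_lt measurable_const hNm
  have hE : μ E ≤ μ (E ∩ {x | s < N x}) := by
    calc μ E ≤ μ (E ∩ {x | s < N x} ∪ E ∩ {x | N x < ε}) := by
          refine measure_mono fun x hx => ?_
          rcases lt_or_ge s (N x) with h | h
          · exact Or.inl ⟨hx, h⟩
          · exact Or.inr ⟨hx, h.trans_lt hsε⟩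
      _ ≤ μ (E ∩ {x | s < N x}) + μ (E ∩ {x | N x < ε}) := measure_union_le _ _
      _ = μ (E ∩ {x | s < N x}) := by
          rw [measure_compl_add_inter_lt hN ha hμ hε hAfin, add_zero]
  refine hE.trans ?_
  by_contra! hlt
  have hcs : 0 < 1 - s / (c + s) := by
    rw [sub_pos, div_lt_one (by positivity)]
    linarith
  have hF : ∀ x ∈ {x | c + s ≤ N x}, ENNReal.ofReal ((1 - s / N x) ^ (-a - 1)) ≤
      ENNReal.ofReal ((1 - s / (c + s)) ^ (-a - 1)) := by
    intro x hx
    refine ENNReal.ofReal_le_ofReal (Real.rpow_le_rpow_of_nonpos hcs ?_ (by linarith))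
    have : s / N x ≤ s / (c + s) := div_le_div_of_nonneg_left hs.le (by positivity) hx
    linarith
  have hEF : ∀ x ∈ (E ∩ {x | s < N x}) \ {x | c + s ≤ N x},
      ENNReal.ofReal ((1 - s / (c + s)) ^ (-a - 1)) ≤
        ENNReal.ofReal ((1 - s / N x) ^ (-a - 1)) := by
    rintro x ⟨⟨-, hx⟩, hx'⟩
    have hx : s < N x := hx
    have hx' : N x < c + s := not_le.1 hx'
    have hx0 : 0 < N x := hs.trans hx
    refine ENNReal.ofReal_le_ofReal (Real.rpow_le_rpow_of_nonpos ?_ ?_ (by linarith))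
    · rwa [sub_pos, div_lt_one hx0]
    · have : s / (c + s) ≤ s / N x := div_le_div_of_nonneg_left hs.le hx0 hx'.le
      linarith
  have hstrict := setLIntegral_lt_of_measure_lt (hEm.inter hsm)
    (measurableSet_le measurable_const hNm)
    (ENNReal.ofReal_pos.2 (Real.rpow_pos_of_pos hcs _)).ne' ENNReal.ofReal_ne_top hF hEF hlt
  rw [setLIntegral_radial_jacobian hN ha hμ hfin hc hs, ← hAc] at hstrict
  refine absurd hstrict (not_lt.2 ?_)
  calc ∫⁻ x in E ∩ {x | s < N x}, ENNReal.ofReal ((1 - s / N x) ^ (-a - 1)) ∂μ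
      ≤ ∫⁻ x in {x | s < N x ∧ (1 - s / N x) • x ∈ Aᶜ},
          ENNReal.ofReal ((1 - s / N x) ^ (-a - 1)) ∂μ := by
        refine lintegral_mono_set fun x ⟨hx, hsx⟩ => ⟨hsx, ?_⟩
        have hx0 : 0 < N x := hs.trans hsx
        refine smul_mem_compl_of_mem_compl_add hN hε hx ?_ ?_
        · have : 0 ≤ s / N x := by positivity
          linarith
        · rwa [sub_sub_cancel, div_mul_cancel₀ _ hx0.ne']
    _ = μ (Aᶜ ∩ {x | 0 < N x}) := setLIntegral_radial_shift hN ha hμ hfin hs hA.compl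
    _ ≤ μ Aᶜ := measure_mono Set.inter_subset_left

/-- The complemented Brunn-Minkowski inequality for `A` and a dilate of the unit ball. -/
theorem measure_compl_add_le (hN : IsPosSeminorm N) (ha : 0 < a)
    (hμ : ∀ A, MeasurableSet A → ∀ t : ℝ, 0 < t → μ (t • A) = ENNReal.ofReal (t ^ (-a)) * μ A)
    (hfin : μ {x | 1 ≤ N x} ≠ ∞) (hA : MeasurableSet A) {c : ℝ} (hc : 0 < c)
    (hε : 0 < ε) (hAc : μ Aᶜ = μ {x | c ≤ N x}) :
    μ (A + ε • openUnitBall N)ᶜ ≤ μ {x | c + ε ≤ N x} := by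
  -- The strict case passes to the limit `s ↑ ε`, as only the right-hand side depends on `s`.
  have hlim : Tendsto (fun s : ℝ => ENNReal.ofReal ((c + s) ^ (-a)) * μ {x | 1 ≤ N x}) (𝓝[<] ε)
      (𝓝 (ENNReal.ofReal ((c + ε) ^ (-a)) * μ {x | 1 ≤ N x})) := by
    refine ENNReal.Tendsto.mul_const (ENNReal.tendsto_ofReal ?_) (Or.inr hfin)
    have : ContinuousAt (fun s : ℝ => (c + s) ^ (-a)) ε :=
      (continuousAt_const.add continuousAt_id).rpow_const (Or.inl (by
        have : 0 < c + ε := by positivity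
        simpa using this.ne'))
    exact this.tendsto.mono_left nhdsWithin_le_nhds
  rw [measure_setOf_le hN hμ (by positivity : 0 < c + ε)]
  refine ge_of_tendsto hlim ?_
  filter_upwards [Ioo_mem_nhdsLT hε] with s hs
  have hs0 : 0 < s := hs.1
  rw [← measure_setOf_le hN hμ (by positivity : 0 < c + s)]
  exact measure_compl_add_le_of_lt hN ha hμ hfin hA hc hs0 hs.2 hAc

theorem measure_add_diff_eq (hN : IsPosSeminorm N) (hε : 0 < ε) (hAfin : μ Aᶜ ≠ ∞) :
    μ ((A + ε • openUnitBall N) \ A) = μ Aᶜ - μ (A + ε • openUnitBall N)ᶜ := by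
  have hsub : (A + ε • openUnitBall N)ᶜ ⊆ Aᶜ :=
    Set.compl_subset_compl.2 (subset_add_smul_openUnitBall hN hε)
  rw [← measure_sdiff hsub (measurableSet_add_smul_openUnitBall hN hε).compl.nullMeasurableSet
    (ne_top_of_le_ne_top hAfin (measure_mono hsub))]
  congr 1
  ext x
  simp [and_comm]

end Enlargement

/-! ### The limit quotient and its closed form -/

section Limits

theorem tendsto_rpow_sub_div {a c M : ℝ} (hc : 0 < c) :
    Tendsto (fun ε : ℝ => ENNReal.ofReal ((c ^ (-a) - (c + ε) ^ (-a)) * M) / ENNReal.ofReal ε)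
      (𝓝[>] 0) (𝓝 (ENNReal.ofReal (a * c ^ (-a - 1) * M))) := by
  have hd : HasDerivAt (fun x : ℝ => -((c + x) ^ (-a) * M)) (a * c ^ (-a - 1) * M) 0 := by
    have h1 : HasDerivAt (fun x : ℝ => c + x) 1 0 := (hasDerivAt_id 0).const_add c
    convert! ((h1.rpow_const (p := -a) (Or.inl (by simpa using hc.ne'))).mul_const M).neg using 1
    simp
  refine (ENNReal.tendsto_ofReal hd.tendsto_slope_zero_right).congr' ?_
  filter_upwards [self_mem_nhdsWithin] with ε hε
  rw [← ENNReal.ofReal_div_of_pos hε]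
  congr 1
  simp only [zero_add, add_zero, smul_eq_mul]
  ring

/-- Matches the isoperimetric bound for a set of measure `c ^ (-a) M`, `a = -1/q`, with the
derivative limit; the exponents agree since `-a (1 - q) = -a - 1`. -/
theorem ofReal_mul_rpow_mul_rpow {q c M : ℝ} (hq : q < 0) (hc : 0 < c) (hM : 0 < M) :
    ENNReal.ofReal (-1 / q) * ENNReal.ofReal M ^ q *
      (ENNReal.ofReal (c ^ (-(-1 / q))) * ENNReal.ofReal M) ^ (1 - q) =
        ENNReal.ofReal ((-1 / q) * c ^ (-(-1 / q) - 1) * M) := by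
  have hq' : 0 < -1 / q := div_pos_of_neg_of_neg (by norm_num) hq
  rw [← ENNReal.ofReal_mul (by positivity), ENNReal.ofReal_rpow_of_pos hM,
    ENNReal.ofReal_rpow_of_pos (by positivity), ← ENNReal.ofReal_mul (by positivity),
    ← ENNReal.ofReal_mul (by positivity)]
  congr 1
  have h1 : -(-1 / q) * (1 - q) = -(-1 / q) - 1 := by
    have := hq.ne
    field_simp
  have h2 : M ^ q * M ^ (1 - q) = M := by
    rw [← Real.rpow_add hM, add_sub_cancel, Real.rpow_one]
  rw [Real.mul_rpow (by positivity) hM.le, ← Real.rpow_mul hc.le, h1, mul_mul_mul_comm, mul_assoc,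
    mul_assoc, mul_comm (c ^ _), mul_left_comm, h2]
  ring

end Limits


/-! ### Extracting scaling laws from homogeneity -/

theorem ENNReal.eq_ofReal_rpow_mul_of_rpow_eq {p t : ℝ} (hp : p ≠ 0) (ht : 0 < t) {x y : ℝ≥0∞}
    (h : x ^ p = ENNReal.ofReal t * y ^ p) : x = ENNReal.ofReal (t ^ (1 / p)) * y := by
  have ht0 : ENNReal.ofReal t ≠ 0 := (ENNReal.ofReal_pos.2 ht).ne'
  have hmul : (ENNReal.ofReal t * y ^ p) ^ (1 / p) = ENNReal.ofReal t ^ (1 / p) * y := by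
    have hy : (y ^ p) ^ (1 / p) = y := by
      rw [← ENNReal.rpow_mul, mul_one_div_cancel hp, ENNReal.rpow_one]
    -- For negative exponents the power of a product needs nonzero factors. If `p < 0`, a zero value
    -- of `y ^ p` means `y = ∞`, and both sides are `∞`.
    by_cases h0 : y ^ p = 0
    · rcases lt_or_gt_of_ne hp with hp' | hp'
      · have hytop : y = ∞ := by
          rw [← hy, h0]
          exact ENNReal.zero_rpow_of_neg (one_div_neg.2 hp')
        have : ENNReal.ofReal t ^ (1 / p) ≠ 0 := by
          rw [ENNReal.ofReal_rpow_of_pos ht]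
          exact (ENNReal.ofReal_pos.2 (Real.rpow_pos_of_pos ht _)).ne'
        rw [h0, hytop, mul_zero, ENNReal.mul_top this]
        exact ENNReal.zero_rpow_of_neg (one_div_neg.2 hp')
      · rw [ENNReal.mul_rpow_of_nonneg _ _ (one_div_pos.2 hp').le, hy]
    · rw [ENNReal.mul_rpow_of_ne_zero ht0 h0, hy]
  rw [← ENNReal.ofReal_rpow_of_pos ht, ← hmul, ← h, ← ENNReal.rpow_mul, mul_one_div_cancel hp,
    ENNReal.rpow_one]

theorem IsHomogeneousMeasure.measure_smul {n : ℕ} {q : ℝ} {μ : Measure (EuclideanSpace ℝ (Fin n))}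
    (hμ : IsHomogeneousMeasure q μ) (hq : q < 0) (A : Set (EuclideanSpace ℝ (Fin n)))
    (hA : MeasurableSet A) (t : ℝ) (ht : 0 < t) :
    μ (t • A) = ENNReal.ofReal (t ^ (-(-1 / q))) * μ A := by
  rw [ENNReal.eq_ofReal_rpow_mul_of_rpow_eq hq.ne ht (hμ A hA t ht), neg_div, neg_neg]

/-- Lebesgue measure contributes `t ^ n` and the density `t ^ (1/p)`, with product `t ^ (1/q)`. -/
theorem IsHomogeneousDensity.isHomogeneousMeasure {n : ℕ} {p q : ℝ}
    {w : EuclideanSpace ℝ (Fin n) → ℝ≥0} (hw : IsHomogeneousDensity p w) (hwm : Measurable w)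
    (hn : n ≠ 0) (hp : p ≠ 0) (hq : q ≠ 0) (hpq : 1 / q = 1 / p + n) :
    IsHomogeneousMeasure q (volume.withDensity fun x => (w x : ℝ≥0∞)) := by
  intro A hA t ht
  have : Nonempty (Fin n) := ⟨⟨0, Nat.pos_of_ne_zero hn⟩⟩
  have : Nontrivial (EuclideanSpace ℝ (Fin n)) := inferInstance
  have hsm : MeasurableSet (t • A) := hA.const_smul_of_ne_zero ht.ne'
  have hwm' : Measurable fun x => (w x : ℝ≥0∞) := hwm.coe_nnreal_ennreal
  have hscale (f : EuclideanSpace ℝ (Fin n) → ℝ≥0∞) (hf : Measurable f) :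
      ∫⁻ x, f x = ENNReal.ofReal (t ^ (n : ℝ)) * ∫⁻ x, f (t • x) := by
    have h := Measure.map_addHaar_smul (volume : Measure (EuclideanSpace ℝ (Fin n))) ht.ne'
    rw [← lintegral_map hf (measurable_const_smul t), h, lintegral_smul_measure, smul_eq_mul,
      ← mul_assoc, ← ENNReal.ofReal_mul (by positivity), finrank_euclideanSpace_fin,
      Real.rpow_natCast, abs_of_pos (by positivity), mul_inv_cancel₀ (by positivity),
      ENNReal.ofReal_one, one_mul]
  have hval : (volume.withDensity fun x => (w x : ℝ≥0∞)) (t • A) =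
      ENNReal.ofReal (t ^ (1 / q)) * (volume.withDensity fun x => (w x : ℝ≥0∞)) A := by
    rw [withDensity_apply _ hsm, withDensity_apply _ hA, ← lintegral_indicator hsm,
      ← lintegral_indicator hA, hscale _ (hwm'.indicator hsm), hpq, add_comm,
      Real.rpow_add ht, ENNReal.ofReal_mul (by positivity), mul_assoc,
      ← lintegral_const_mul _ (hwm'.indicator hA)]
    congr 1
    refine lintegral_congr_ae ?_
    -- Homogeneity of `w` says nothing at the origin, which is null because the dimension is
    -- positive.
    filter_upwards [compl_mem_ae_iff.2 (measure_singleton (μ := volume) 0)] with x hx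
    have hx0 : x ≠ 0 := hx
    have hmem : t • x ∈ t • A ↔ x ∈ A := Set.smul_mem_smul_set_iff₀ ht.ne' A x
    by_cases hxA : x ∈ A
    · rw [Set.indicator_of_mem (hmem.2 hxA), Set.indicator_of_mem hxA,
        ENNReal.eq_ofReal_rpow_mul_of_rpow_eq hp ht (hw x hx0 t ht)]
    · rw [Set.indicator_of_notMem (hmem.not.2 hxA), Set.indicator_of_notMem hxA, mul_zero]
  have ht' : 0 < t ^ (1 / q) := Real.rpow_pos_of_pos ht _
  rw [hval]
  have hpow : ENNReal.ofReal (t ^ (1 / q)) ^ q = ENNReal.ofReal t := by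
    rw [ENNReal.ofReal_rpow_of_pos ht', ← Real.rpow_mul ht.le, one_div_mul_cancel hq,
      Real.rpow_one]
  rw [ENNReal.mul_rpow_eq_ite, hpow, if_neg]
  rintro ⟨h | h, -⟩
  · exact (ENNReal.ofReal_pos.2 ht').ne' h.1
  · exact ENNReal.ofReal_ne_top h.1

/-! ### The isoperimetric inequality and its equality case -/

section Isoperimetry

variable {n : ℕ} {N : EuclideanSpace ℝ (Fin n) → ℝ} {μ : Measure (EuclideanSpace ℝ (Fin n))}
  {q : ℝ}

theorem measure_compl_add_eq_zero (hN : IsPosSeminorm N) {a : ℝ} (ha : 0 < a)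
    (hμ : ∀ A, MeasurableSet A → ∀ t : ℝ, 0 < t → μ (t • A) = ENNReal.ofReal (t ^ (-a)) * μ A)
    (h0 : μ {x | 1 ≤ N x} = 0) {A : Set (EuclideanSpace ℝ (Fin n))} (hAfin : μ Aᶜ ≠ ∞) {ε : ℝ}
    (hε : 0 < ε) : μ (A + ε • openUnitBall N)ᶜ = 0 := by
  have hεN : μ {x | ε ≤ N x} = 0 := by rw [measure_setOf_le hN hμ hε, h0, mul_zero]
  refine measure_mono_null (fun x hx => ?_)
    (measure_union_null (measure_compl_add_inter_lt hN ha hμ hε hAfin) hεN)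
  rcases lt_or_ge (N x) ε with h | h
  · exact Or.inl ⟨hx, h⟩
  · exact Or.inr h

theorem le_innerBoundaryMeasure (hN : IsPosSeminorm N) (hq : q < 0)
    (hμ : IsHomogeneousMeasure q μ) (hfin : μ (openUnitBall N)ᶜ < ∞)
    {C : Set (EuclideanSpace ℝ (Fin n))} (hC : MeasurableSet C) (hCfin : μ C < ∞) :
    ENNReal.ofReal (-1 / q) * μ (openUnitBall N)ᶜ ^ q * μ C ^ (1 - q) ≤
      innerBoundaryMeasure μ (openUnitBall N) C := by
  have ha : 0 < -1 / q := div_pos_of_neg_of_neg (by norm_num) hq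
  have hμ' := hμ.measure_smul hq
  rcases eq_or_ne (μ C) 0 with hC0 | hC0
  -- Here `1 - q > 0`, so the bound vanishes by `∞ * 0 = 0` even if `μ Kᶜ ^ q = ∞`.
  · rw [hC0, ENNReal.zero_rpow_of_pos (by linarith), mul_zero]
    exact zero_le
  have hCfin' : μ Cᶜᶜ ≠ ∞ := by rw [compl_compl]; exact hCfin.ne
  have hquot {ε : ℝ} (hε : 0 < ε) : μ ((Cᶜ + ε • openUnitBall N) \ Cᶜ) =
      μ C - μ (Cᶜ + ε • openUnitBall N)ᶜ := by
    rw [measure_add_diff_eq hN hε hCfin', compl_compl]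
  rw [IsPosSeminorm.compl_openUnitBall] at hfin ⊢
  rw [innerBoundaryMeasure, outerBoundaryMeasure]
  rcases eq_or_ne (μ {x | 1 ≤ N x}) 0 with h0 | h0
  -- No level set of `N` can match `μ C` in this case; instead each enlargement of `Cᶜ` has null
  -- complement, so the quotient is `μ C / ε → ∞`.
  · have hlim : Tendsto (fun ε : ℝ => μ ((Cᶜ + ε • openUnitBall N) \ Cᶜ) / ENNReal.ofReal ε)
        (𝓝[>] 0) (𝓝 ∞) := by
      have hof : Tendsto ENNReal.ofReal (𝓝[>] 0) (𝓝 0) := by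
        simpa using (ENNReal.continuous_ofReal.tendsto 0).mono_left nhdsWithin_le_nhds
      have h := ENNReal.Tendsto.const_div (a := μ C) hof (Or.inl ENNReal.zero_ne_top)
      rw [ENNReal.div_zero hC0] at h
      refine h.congr' ?_
      filter_upwards [self_mem_nhdsWithin] with ε hε
      rw [hquot hε, measure_compl_add_eq_zero hN ha hμ' h0 hCfin' hε, tsub_zero]
    rw [hlim.liminf_eq]
    exact le_top
  set M := (μ {x | 1 ≤ N x}).toReal with hM
  set V := (μ C).toReal with hV
  have hMpos : 0 < M := ENNReal.toReal_pos h0 hfin.ne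
  have hVpos : 0 < V := ENNReal.toReal_pos hC0 hCfin.ne
  have hMof : μ {x | 1 ≤ N x} = ENNReal.ofReal M := (ENNReal.ofReal_toReal hfin.ne).symm
  obtain ⟨c, hc, hcV⟩ : ∃ c : ℝ, 0 < c ∧ c ^ (-(-1 / q)) = V / M := by
    -- Solves `c ^ (1/q) = V / M`, so that `{N ≥ c}` has the measure of `C`.
    refine ⟨(V / M) ^ q, by positivity, ?_⟩
    rw [← Real.rpow_mul (by positivity), neg_div, neg_neg, mul_one_div_cancel hq.ne, Real.rpow_one]
  have hCc : μ C = ENNReal.ofReal (c ^ (-(-1 / q))) * ENNReal.ofReal M := by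
    rw [← ENNReal.ofReal_mul (by positivity), hcV, div_mul_cancel₀ _ hMpos.ne', hV,
      ENNReal.ofReal_toReal hCfin.ne]
  have hCc' : μ Cᶜᶜ = μ {x | c ≤ N x} := by
    rw [compl_compl, measure_setOf_le hN hμ' hc, hMof, hCc]
  rw [hMof, hCc, ofReal_mul_rpow_mul_rpow hq hc hMpos, ← (tendsto_rpow_sub_div hc).liminf_eq]
  refine liminf_le_liminf ?_
  filter_upwards [self_mem_nhdsWithin] with ε hε
  have hε : 0 < ε := hε
  refine ENNReal.div_le_div_right ?_ _
  rw [hquot hε, sub_mul, ENNReal.ofReal_sub _ (by positivity), ENNReal.ofReal_mul (by positivity),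
    ENNReal.ofReal_mul (by positivity), ← hCc]
  refine tsub_le_tsub_left ?_ _
  rw [← hMof, ← measure_setOf_le hN hμ' (by positivity)]
  exact measure_compl_add_le hN ha hμ' hfin.ne hC.compl hc hε hCc'

/-- Subadditivity gives one inclusion; for the other, split `x` into pieces proportional to `t` and
`ε`. -/
theorem setOf_lt_add_smul_openUnitBall (hN : IsPosSeminorm N) {t ε : ℝ} (ht : 0 < t)
    (hε : 0 < ε) : t • openUnitBall N + ε • openUnitBall N = {x | N x < t + ε} := by
  have htε : 0 < t + ε := by positivity
  rw [hN.smul_openUnitBall ht, hN.smul_openUnitBall hε]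
  ext x
  constructor
  · rintro ⟨y, hy, z, hz, rfl⟩
    exact (hN.add_le y z).trans_lt (add_lt_add hy hz)
  · intro hx
    have hx' : N x / (t + ε) < 1 := (div_lt_one htε).2 hx
    refine ⟨(t / (t + ε)) • x, ?_, (ε / (t + ε)) • x, ?_, ?_⟩
    · rw [Set.mem_ofPred_eq, hN.smul_eq _ _ (by positivity), div_mul_eq_mul_div, mul_div_assoc]
      exact mul_lt_of_lt_one_right ht hx'
    · rw [Set.mem_ofPred_eq, hN.smul_eq _ _ (by positivity), div_mul_eq_mul_div, mul_div_assoc]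
      exact mul_lt_of_lt_one_right hε hx'
    · simp only
      rw [← add_smul, ← add_div, div_self htε.ne', one_smul]

theorem compl_setOf_lt (N : EuclideanSpace ℝ (Fin n) → ℝ) (t : ℝ) :
    {x | N x < t}ᶜ = {x | t ≤ N x} := by
  ext x
  simp

theorem innerBoundaryMeasure_compl_smul_openUnitBall (hN : IsPosSeminorm N) (hq : q < 0)
    (hμ : IsHomogeneousMeasure q μ) (hfin : μ (openUnitBall N)ᶜ < ∞) {t : ℝ} (ht : 0 < t) :
    innerBoundaryMeasure μ (openUnitBall N) (t • openUnitBall N)ᶜ =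
      ENNReal.ofReal (-1 / q) * μ (openUnitBall N)ᶜ ^ q *
        μ (t • openUnitBall N)ᶜ ^ (1 - q) := by
  have hμ' := hμ.measure_smul hq
  rw [IsPosSeminorm.compl_openUnitBall] at hfin ⊢
  have htc : (t • openUnitBall N)ᶜ = {x | t ≤ N x} := by
    rw [hN.smul_openUnitBall ht, compl_setOf_lt]
  set M := (μ {x | 1 ≤ N x}).toReal with hM
  have hMof : μ {x | 1 ≤ N x} = ENNReal.ofReal M := (ENNReal.ofReal_toReal hfin.ne).symm
  have hM0 : 0 ≤ M := ENNReal.toReal_nonneg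
  have htfin : μ (t • openUnitBall N)ᶜ ≠ ∞ := by
    rw [htc, measure_setOf_le hN hμ' ht]
    exact ENNReal.mul_ne_top ENNReal.ofReal_ne_top hfin.ne
  have hlim : Tendsto (fun ε : ℝ =>
      μ ((t • openUnitBall N + ε • openUnitBall N) \ t • openUnitBall N) / ENNReal.ofReal ε)
      (𝓝[>] 0) (𝓝 (ENNReal.ofReal ((-1 / q) * t ^ (-(-1 / q) - 1) * M))) := by
    refine (tendsto_rpow_sub_div ht).congr' ?_
    filter_upwards [self_mem_nhdsWithin] with ε hε
    have hε : 0 < ε := hε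
    have htε : 0 < t + ε := by positivity
    rw [measure_add_diff_eq hN hε htfin, htc, setOf_lt_add_smul_openUnitBall hN ht hε,
      compl_setOf_lt, measure_setOf_le hN hμ' ht, measure_setOf_le hN hμ' htε, hMof, sub_mul,
      ENNReal.ofReal_sub _ (by positivity), ENNReal.ofReal_mul (by positivity),
      ENNReal.ofReal_mul (by positivity)]
  rw [innerBoundaryMeasure, outerBoundaryMeasure, compl_compl, hlim.liminf_eq, htc,
    measure_setOf_le hN hμ' ht, hMof]
  rcases hM0.eq_or_lt with h0 | hMpos
  -- If `μ Kᶜ = 0`, both sides are zero, again by `∞ * 0 = 0`.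
  · rw [← h0, ENNReal.ofReal_zero, mul_zero, mul_zero,
      ENNReal.zero_rpow_of_pos (by linarith : 0 < 1 - q), mul_zero, ENNReal.ofReal_zero]
  · rw [ofReal_mul_rpow_mul_rpow hq ht hMpos]

theorem isInnerIsoperimetricMinimizer_compl_smul_openUnitBall (hN : IsPosSeminorm N) (hq : q < 0)
    (hμ : IsHomogeneousMeasure q μ) (hfin : μ (openUnitBall N)ᶜ < ∞) {t : ℝ} (ht : 0 < t) :
    IsInnerIsoperimetricMinimizer μ (openUnitBall N) (t • openUnitBall N)ᶜ := by
  have htc : (t • openUnitBall N)ᶜ = {x | t ≤ N x} := by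
    rw [hN.smul_openUnitBall ht, compl_setOf_lt]
  refine ⟨?_, fun D hD hDt => ?_⟩
  · rw [htc]
    exact measurableSet_le measurable_const hN.continuous.measurable
  · have hDfin : μ D < ∞ := by
      rw [hDt, htc, measure_setOf_le hN (hμ.measure_smul hq) ht]
      rw [IsPosSeminorm.compl_openUnitBall] at hfin
      exact ENNReal.mul_lt_top ENNReal.ofReal_lt_top hfin
    rw [innerBoundaryMeasure_compl_smul_openUnitBall hN hq hμ hfin ht, ← hDt]
    exact le_innerBoundaryMeasure hN hq hμ hfin hD hDfin

end Isoperimetry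

theorem mainTheorem2 (n : ℕ) (N : EuclideanSpace ℝ (Fin n) → ℝ) (hN : IsPosSeminorm N)
    (K : Set (EuclideanSpace ℝ (Fin n))) (hK : K = openUnitBall N) :
    -- sigma-finite homogeneous measures
    (∀ (q : ℝ) (μ : Measure (EuclideanSpace ℝ (Fin n))), q < 0 → SigmaFinite μ →
      IsHomogeneousMeasure q μ → μ Kᶜ < ∞ →
        (∀ C : Set (EuclideanSpace ℝ (Fin n)), MeasurableSet C → μ C < ∞ →
          ENNReal.ofReal (-1 / q) * μ Kᶜ ^ q * μ C ^ (1 - q) ≤ innerBoundaryMeasure μ K C) ∧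
        (∀ t : ℝ, 0 < t →
          innerBoundaryMeasure μ K (t • K)ᶜ =
            ENNReal.ofReal (-1 / q) * μ Kᶜ ^ q * μ (t • K)ᶜ ^ (1 - q)) ∧
        (∀ t : ℝ, 0 < t → IsInnerIsoperimetricMinimizer μ K (t • K)ᶜ)) ∧
    -- measures with a homogeneous density
    (∀ (p q : ℝ) (w : EuclideanSpace ℝ (Fin n) → ℝ≥0) (μ : Measure (EuclideanSpace ℝ (Fin n))),
      -1 / (n : ℝ) < p → p < 0 → 1 / q = 1 / p + n →
      Measurable w → IsHomogeneousDensity p w →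
      μ = volume.withDensity (fun x => (w x : ℝ≥0∞)) → μ Kᶜ < ∞ →
        (∀ C : Set (EuclideanSpace ℝ (Fin n)), MeasurableSet C → μ C < ∞ →
          ENNReal.ofReal (-1 / q) * μ Kᶜ ^ q * μ C ^ (1 - q) ≤ innerBoundaryMeasure μ K C) ∧
        (∀ t : ℝ, 0 < t →
          innerBoundaryMeasure μ K (t • K)ᶜ =
            ENNReal.ofReal (-1 / q) * μ Kᶜ ^ q * μ (t • K)ᶜ ^ (1 - q)) ∧
        (∀ t : ℝ, 0 < t → IsInnerIsoperimetricMinimizer μ K (t • K)ᶜ)) := by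
  subst hK
  have core (q : ℝ) (μ : Measure (EuclideanSpace ℝ (Fin n))) (hq : q < 0)
      (hμ : IsHomogeneousMeasure q μ) (hfin : μ (openUnitBall N)ᶜ < ∞) :=
    And.intro (fun C hC hCfin => le_innerBoundaryMeasure hN hq hμ hfin (C := C) hC hCfin)
      (And.intro (fun t ht => innerBoundaryMeasure_compl_smul_openUnitBall hN hq hμ hfin (t := t) ht)
        (fun t ht =>
          isInnerIsoperimetricMinimizer_compl_smul_openUnitBall hN hq hμ hfin (t := t) ht))
  refine ⟨fun q μ hq _ hμ hfin => core q μ hq hμ hfin, ?_⟩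
  rintro p q w μ hnp hp hpq hwm hw rfl hfin
  -- With `-1 / 0 = 0`, dimension zero would give `0 < p < 0`.
  have hn : n ≠ 0 := by
    rintro rfl
    simp only [Nat.cast_zero, div_zero] at hnp
    exact lt_asymm hnp hp
  -- `1/q = (1 + p n) / p`, whose numerator is positive exactly because `p > -1/n`.
  have hq : q < 0 := by
    have hn' : (0 : ℝ) < n := by positivity
    rw [← one_div_neg, hpq]
    have h1 : -1 < p * n := (div_lt_iff₀ hn').1 hnp
    have h2 : 1 / p + n = (1 + p * n) / p := by
      have := hp.ne
      field_simp
    rw [h2]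
    exact div_neg_of_pos_of_neg (by linarith) hp
  exact core q _ hq (hw.isHomogeneousMeasure hwm hn hp.ne hq.ne hpq) hfin
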